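/- All groups and rings are commutative. For a group $G$, a $G$-graded ring is a ring $R$ together with a family $(R_g)_{g\in G}$ of additive subgroups such that $R=\bigoplus_{g\in G}R_g$ and $R_gR_{g'}\subseteq R_{g+g'}$ for all $g,g'\in G$; a morphism of $G$-graded rings $h\colon R\to S$ is a (unital) ring homomorphism with $h(R_g)\subseteq S_g$ for all $g\in G$. For an epimorphism (that is, a surjective homomorphism) of groups $\psi\colon G\to H$, the $\psi$-coarsening functor $\bullet_{[\psi]}$ from the category of $G$-graded rings to the category of $H$-graded rings maps $R$ to the $H$-graded ring $R_{[\psi]}$ with the same underlying ring and with components $(R_{[\psi]})_d=\bigoplus_{g\in\psi^{-1}(d)}R_g$ for $d\in H$, and it maps a morphism $h$ to the morphism $h_{[\psi]}$ with the same underlying map. Let $\psi\colon G\to H$ be an epimorphism of groups. A morphism $h\colon R\to S$ of $G$-graded rings is an epimorphism in the category of $G$-graded rings if and only if $h_{[\psi]}\colon R_{[\psi]}\to S_{[\psi]}$ is an epimorphism in the category of $H$-graded rings. In particular, the functor $\bullet_{[\psi]}$ preserves and reflects epimorphisms. -/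

import Mathlib

open CategoryTheory

universe u v w

/-- A (commutative) `G`-graded ring: a commutative ring together with a family of additive
subgroups indexed by `G` that is a grading in the sense of Mathlib's `GradedRing`. -/
structure GrCommRingCat (G : Type v) [AddCommGroup G] [DecidableEq G] where
  carrier : Type u
  [commRing : CommRing carrier]
  grading : G → AddSubgroup carrier
  [gradedRing : GradedRing grading]

namespace GrCommRingCat

attribute [instance] GrCommRingCat.commRing GrCommRingCat.gradedRing

/-- The category of `G`-graded commutative rings; its morphisms are the ring homomorphisms that
map the component of degree `g` into the component of degree `g`, for every `g`. -/
instance category (G : Type v) [AddCommGroup G] [DecidableEq G] :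
    Category (GrCommRingCat.{u} G) where
  Hom R S := GradedRingHom R.grading S.grading
  id R := GradedRingHom.id R.grading
  comp f g := GradedRingHom.comp g f

section Coarsening

variable {G : Type v} {H : Type w} [AddCommGroup G] [AddCommGroup H]

/-- The coarsened family: its component of degree `d` is the sum of the components of all
degrees `g` with `ψ g = d`. -/
def coarseGrading {A : Type u} [CommRing A] (ψ : G →+ H) (𝒜 : G → AddSubgroup A) (d : H) :
    AddSubgroup A :=
  ⨆ g : {g : G // ψ g = d}, 𝒜 g

theorem le_coarseGrading {A : Type u} [CommRing A] (ψ : G →+ H) (𝒜 : G → AddSubgroup A) (g : G) :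
    𝒜 g ≤ coarseGrading ψ 𝒜 (ψ g) :=
  le_iSup (fun g' : {g' : G // ψ g' = ψ g} => 𝒜 g') ⟨g, rfl⟩

theorem coarseGrading_induction {A : Type u} [CommRing A] {ψ : G →+ H} {𝒜 : G → AddSubgroup A}
    {d : H} (p : A → Prop) {x : A} (hx : x ∈ coarseGrading ψ 𝒜 d)
    (mem : ∀ g : G, ψ g = d → ∀ y ∈ 𝒜 g, p y) (zero : p 0)
    (add : ∀ y z, p y → p z → p (y + z)) : p x :=
  AddSubgroup.iSup_induction (fun g : {g : G // ψ g = d} => 𝒜 g) (C := p) hx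
    (fun g y hy => mem g.1 g.2 y hy) zero add

variable [DecidableEq G] [DecidableEq H]

/-- The additive map sending an element to the family of its `ψ`-coarsened components. -/
def coarseDecompose {A : Type u} [CommRing A] (ψ : G →+ H) (𝒜 : G → AddSubgroup A)
    [GradedRing 𝒜] : A →+ DirectSum H (fun d => coarseGrading ψ 𝒜 d) :=
  (DirectSum.toAddMonoid fun g =>
    (DirectSum.of (fun d => coarseGrading ψ 𝒜 d) (ψ g)).comp
      (AddSubgroup.inclusion (le_coarseGrading ψ 𝒜 g))).comp
    (DirectSum.decomposeAddEquiv 𝒜).toAddMonoidHom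

theorem coarseDecompose_of_mem {A : Type u} [CommRing A] (ψ : G →+ H) (𝒜 : G → AddSubgroup A)
    [GradedRing 𝒜] (g : G) (x : A) (hx : x ∈ 𝒜 g) :
    coarseDecompose ψ 𝒜 x =
      DirectSum.of (fun d => coarseGrading ψ 𝒜 d) (ψ g) ⟨x, le_coarseGrading ψ 𝒜 g hx⟩ := by
  simp only [coarseDecompose, AddMonoidHom.comp_apply]
  change DirectSum.toAddMonoid _ (DirectSum.decompose 𝒜 x) = _
  rw [DirectSum.decompose_of_mem 𝒜 hx, DirectSum.toAddMonoid_of]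
  rfl

/-- The coarsened family is again a grading. -/
instance coarseGradedRing {A : Type u} [CommRing A] (ψ : G →+ H) (𝒜 : G → AddSubgroup A)
    [GradedRing 𝒜] : GradedRing (coarseGrading ψ 𝒜) where
  one_mem := by
    have h := le_coarseGrading ψ 𝒜 0 (SetLike.GradedOne.one_mem (A := 𝒜))
    rwa [map_zero] at h
  mul_mem := by
    intro i j x y hx hy
    refine coarseGrading_induction (fun x => x * y ∈ coarseGrading ψ 𝒜 (i + j)) hx ?_
      (by simp) (fun a b ha hb => by
        simp only [add_mul]; exact add_mem ha hb)
    rintro g rfl a ha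
    refine coarseGrading_induction (fun y => a * y ∈ coarseGrading ψ 𝒜 (ψ g + j)) hy ?_
      (by simp) (fun b c hb hc => by
        simp only [mul_add]; exact add_mem hb hc)
    rintro g' rfl b hb
    rw [← map_add]
    exact le_coarseGrading ψ 𝒜 _ (SetLike.GradedMul.mul_mem ha hb)
  toDecomposition := DirectSum.Decomposition.ofAddHom _ (coarseDecompose ψ 𝒜)
    (by
      ext x
      refine DirectSum.Decomposition.inductionOn 𝒜 (by simp) ?_ ?_ x
      · intro g y
        simp [coarseDecompose_of_mem ψ 𝒜 g y.1 y.2]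
      · intro a b ha hb
        rw [map_add, ha, hb, map_add])
    (by
      refine DirectSum.addHom_ext fun d y => ?_
      obtain ⟨y, hy⟩ := y
      simp only [AddMonoidHom.comp_apply, DirectSum.coeAddMonoidHom_of, AddMonoidHom.id_apply]
      have key : ∃ h : y ∈ coarseGrading ψ 𝒜 d, coarseDecompose ψ 𝒜 y =
          DirectSum.of (fun d => coarseGrading ψ 𝒜 d) d ⟨y, h⟩ := by
        refine coarseGrading_induction (fun y => ∃ h : y ∈ coarseGrading ψ 𝒜 d,
          coarseDecompose ψ 𝒜 y =
            DirectSum.of (fun d => coarseGrading ψ 𝒜 d) d ⟨y, h⟩) hy ?_ ?_ ?_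
        · rintro g rfl a ha
          exact ⟨le_coarseGrading ψ 𝒜 g ha, coarseDecompose_of_mem ψ 𝒜 g a ha⟩
        · exact ⟨zero_mem _, by
            rw [map_zero]
            exact (map_zero (DirectSum.of (fun d => coarseGrading ψ 𝒜 d) d)).symm⟩
        · rintro a b ⟨ha, ha'⟩ ⟨hb, hb'⟩
          refine ⟨add_mem ha hb, ?_⟩
          rw [map_add, ha', hb', ← map_add]
          rfl
      exact key.2)

/-- The `ψ`-coarsening functor `R ↦ R_[ψ]`, `h ↦ h_[ψ]`: the underlying ring and the underlying
ring homomorphism are unchanged. -/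
def coarsening (ψ : G →+ H) : GrCommRingCat.{u} G ⥤ GrCommRingCat.{u} H where
  obj R := { carrier := R.carrier, grading := coarseGrading ψ R.grading }
  map {R S} h :=
    { toRingHom := GradedRingHom.toRingHom h
      map_mem := by
        intro d x hx
        refine coarseGrading_induction
          (fun x => GradedRingHom.toRingHom h x ∈ coarseGrading ψ S.grading d) hx ?_ ?_ ?_
        · rintro g rfl y hy
          exact le_coarseGrading ψ S.grading g (GradedRingHom.map_mem h hy)
        · rw [map_zero]
          exact zero_mem _
        · intro y z hy hz
          rw [map_add]
          exact add_mem hy hz }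
  map_id _ := rfl
  map_comp _ _ := rfl

end Coarsening

end GrCommRingCat

/-!
A morphism of `G`-graded commutative rings is an epimorphism if and only if its underlying ring
homomorphism is right-cancellable among commutative rings of the same universe. This condition does
not see the grading, and coarsening does not change the underlying ring homomorphism.

To see that a graded epimorphism `h : R ⟶ S` is right-cancellable, take ring homomorphisms
`a, b : S → A` that agree after `h`. Over the group algebra `A[G]`, graded by its exponents, they
become the graded homomorphisms `S → A[G]` sending `s` of degree `g` to `a s · g` and to `b s · g`.
These agree after `h`, hence are equal, and comparing coefficients gives `a = b`
(`GrCommRingCat.ringHom_cancel_of_epi`).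

The group `G` may live in a larger universe than the rings, in which case `A[G]` is not an object
of the category. It is replaced by `A[M]`, where `M` is a group in the universe of the rings with an
injective homomorphism into `G` whose range contains every degree `g` with `S_g ≠ 0`
(`exists_injective_addMonoidHom_support`); the degree of an exponent is its image in `G`.
-/

open AddMonoidAlgebra

/-- The group algebra `A[M]`, graded over `G` along `ι : M →+ G`, with additive subgroups as
components. -/
noncomputable instance AddMonoidAlgebra.gradeByAddSubgroup.gradedRing {A : Type u} [CommRing A] {M : Type u}
    {G : Type v} [AddCommGroup M] [AddCommGroup G] [DecidableEq G] (ι : M →+ G) :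
    GradedRing fun g : G => (gradeBy A ι g).toAddSubgroup where
  one_mem := SetLike.GradedOne.one_mem (A := gradeBy A ι)
  mul_mem _ _ _ _ hx hy := SetLike.GradedMul.mul_mem (A := gradeBy A ι) hx hy
  decompose' := (gradeBy.gradedAlgebra (R := A) ι).decompose'
  left_inv := (gradeBy.gradedAlgebra (R := A) ι).left_inv
  right_inv := (gradeBy.gradedAlgebra (R := A) ι).right_inv

/-- The subgroup generated by the degrees of the nonzero homogeneous elements is, up to isomorphism,
a group in the universe of the ring: a quotient of the free abelian group on these elements. -/
theorem exists_injective_addMonoidHom_support {G : Type v} [AddCommGroup G] [DecidableEq G]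
    {S : Type u} [CommRing S] (𝒮 : G → AddSubgroup S) [GradedRing 𝒮] :
    ∃ (M : Type u) (_ : AddCommGroup M) (ι : M →+ G), Function.Injective ι ∧
      ∀ g, ∀ s ∈ 𝒮 g, s ≠ 0 → g ∈ Set.range ι := by
  let D := {s : S // s ≠ 0 ∧ ∃ g, s ∈ 𝒮 g}
  let deg : D → G := fun s => s.2.2.choose
  let F : FreeAbelianGroup D →+ G := FreeAbelianGroup.lift deg
  refine ⟨FreeAbelianGroup D ⧸ F.ker, inferInstance, QuotientAddGroup.kerLift F,
    QuotientAddGroup.kerLift_injective F, fun g s hs h0 => ?_⟩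
  let d : D := ⟨s, h0, g, hs⟩
  refine ⟨(FreeAbelianGroup.of d : FreeAbelianGroup D), ?_⟩
  rw [QuotientAddGroup.kerLift_mk, FreeAbelianGroup.lift_apply_of]
  exact DirectSum.degree_eq_of_mem_mem 𝒮 d.2.2.choose_spec hs h0

namespace GrCommRingCat

/-- The `G`-graded ring `A[M]`, graded along `ι : M →+ G`. -/
noncomputable def groupAlgebra {G : Type v} [AddCommGroup G] [DecidableEq G] (A : Type u) [CommRing A]
    {M : Type u} [AddCommGroup M] (ι : M →+ G) : GrCommRingCat.{u} G where
  carrier := AddMonoidAlgebra A M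
  grading g := (gradeBy A ι g).toAddSubgroup

section Twist

variable {G : Type v} [AddCommGroup G] [DecidableEq G] {S : Type u} [CommRing S]
  {𝒮 : G → AddSubgroup S} [GradedRing 𝒮] {A : Type u} [CommRing A] {M : Type u} [AddCommGroup M]
  {ι : M →+ G}

/-- The ring homomorphism `S → A[M]` sending `s` of degree `g` to `a s` times the exponent lying
over `g`. The value of `Function.invFun ι` at degrees outside the range of `ι` is irrelevant, since
there the component of `S` is zero. -/
noncomputable def twistRingHom (hι : Function.Injective ι)
    (hS : ∀ g, ∀ s ∈ 𝒮 g, s ≠ 0 → g ∈ Set.range ι) (a : S →+* A) :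
    S →+* AddMonoidAlgebra A M :=
  (DirectSum.toSemiring (A := fun g => 𝒮 g)
    (fun g => (singleAddHom (Function.invFun ι g)).comp
      ((a : S →+ A).comp (𝒮 g).subtype))
    (by
      have h0 : Function.invFun ι 0 = 0 := by
        simpa using Function.leftInverse_invFun hι 0
      change single (Function.invFun ι 0) (a 1) = 1
      rw [h0, map_one, one_def])
    (by
      rintro g g' ⟨s, hs⟩ ⟨t, ht⟩
      change single (Function.invFun ι (g + g')) (a (s * t)) =
        single (Function.invFun ι g) (a s) * single (Function.invFun ι g') (a t)
      by_cases hs0 : s = 0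
      · simp [hs0]
      by_cases ht0 : t = 0
      · simp [ht0]
      obtain ⟨m, rfl⟩ := hS g s hs hs0
      obtain ⟨n, rfl⟩ := hS g' t ht ht0
      rw [← map_add, Function.leftInverse_invFun hι, Function.leftInverse_invFun hι,
        Function.leftInverse_invFun hι, single_mul_single, map_mul])).comp
    (DirectSum.decomposeRingEquiv 𝒮 : S →+* DirectSum G fun g => 𝒮 g)

theorem twistRingHom_of_mem (hι : Function.Injective ι)
    (hS : ∀ g, ∀ s ∈ 𝒮 g, s ≠ 0 → g ∈ Set.range ι) (a : S →+* A) {g : G} {s : S} (hs : s ∈ 𝒮 g) :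
    twistRingHom hι hS a s = single (Function.invFun ι g) (a s) := by
  rw [twistRingHom, RingHom.comp_apply]
  exact (congrArg (DirectSum.toSemiring _ _ _) (DirectSum.decompose_of_mem 𝒮 hs)).trans
    (DirectSum.toSemiring_of _ _ _ _ _)

theorem twistRingHom_mem (hι : Function.Injective ι)
    (hS : ∀ g, ∀ s ∈ 𝒮 g, s ≠ 0 → g ∈ Set.range ι) (a : S →+* A) {g : G} {s : S} (hs : s ∈ 𝒮 g) :
    twistRingHom hι hS a s ∈ gradeBy A ι g := by
  rw [twistRingHom_of_mem hι hS a hs]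
  by_cases hs0 : s = 0
  · rw [hs0, map_zero, single_zero]
    exact zero_mem _
  · obtain ⟨m, rfl⟩ := hS g s hs hs0
    rw [Function.leftInverse_invFun hι]
    exact single_mem_gradeBy ι m (a s)

end Twist

/-- The underlying ring homomorphism of an epimorphism of graded rings is an epimorphism of
commutative rings. -/
theorem ringHom_cancel_of_epi {G : Type v} [AddCommGroup G] [DecidableEq G]
    {R S : GrCommRingCat.{u} G} (h : R ⟶ S) [Epi h] {A : Type u} [CommRing A]
    (a b : S.carrier →+* A)
    (hab : ∀ r, a (GradedRingHom.toRingHom h r) = b (GradedRingHom.toRingHom h r)) : a = b := by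
  obtain ⟨M, _, ι, hι, hS⟩ := exists_injective_addMonoidHom_support S.grading
  let twist (c : S.carrier →+* A) : S ⟶ groupAlgebra A ι :=
    { toRingHom := twistRingHom hι hS c, map_mem := twistRingHom_mem hι hS c }
  have hcomp : h ≫ twist a = h ≫ twist b := by
    refine GradedRingHom.ext fun r => ?_
    change twistRingHom hι hS a (GradedRingHom.toRingHom h r) =
      twistRingHom hι hS b (GradedRingHom.toRingHom h r)
    refine DirectSum.Decomposition.inductionOn R.grading (by simp) ?_ ?_ r
    · intro g y
      have hy := GradedRingHom.map_mem h y.2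
      rw [twistRingHom_of_mem hι hS a hy, twistRingHom_of_mem hι hS b hy, hab]
    · intro x y hx hy
      simp only [map_add, hx, hy]
  have heq := (cancel_epi h).1 hcomp
  refine RingHom.ext fun s => ?_
  refine DirectSum.Decomposition.inductionOn S.grading (by simp) ?_ ?_ s
  · intro g y
    have hy : twistRingHom hι hS a y = twistRingHom hι hS b y := GradedRingHom.congr_fun heq y
    rw [twistRingHom_of_mem hι hS a y.2, twistRingHom_of_mem hι hS b y.2] at hy
    exact single_right_injective hy
  · intro x y hx hy
    rw [map_add, map_add, hx, hy]

variable {G : Type v} {H : Type w} [AddCommGroup G] [AddCommGroup H] [DecidableEq G]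
  [DecidableEq H] (ψ : G →+ H)

instance coarsening_faithful : (coarsening.{u} ψ).Faithful where
  map_injective h := GradedRingHom.ext fun x => GradedRingHom.congr_fun h x

instance coarsening_preservesEpimorphisms : (coarsening.{u} ψ).PreservesEpimorphisms where
  preserves h _ :=
    ⟨fun a b hab => GradedRingHom.ext <| RingHom.congr_fun <|
      ringHom_cancel_of_epi h (GradedRingHom.toRingHom a) (GradedRingHom.toRingHom b)
        fun r => GradedRingHom.congr_fun hab r⟩

end GrCommRingCat

theorem mainTheorem2 {G : Type v} {H : Type w} [AddCommGroup G] [AddCommGroup H]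
    [DecidableEq G] [DecidableEq H] (ψ : G →+ H) (hψ : Function.Surjective ψ) :
    (∀ (R S : GrCommRingCat.{u} G) (h : R ⟶ S),
      Epi h ↔ Epi ((GrCommRingCat.coarsening.{u} ψ).map h)) ∧
    (GrCommRingCat.coarsening.{u} ψ).PreservesEpimorphisms ∧
    (GrCommRingCat.coarsening.{u} ψ).ReflectsEpimorphisms :=
  ⟨fun _ _ h => ((GrCommRingCat.coarsening.{u} ψ).epi_map_iff_epi h).symm,
    inferInstance, inferInstance⟩
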